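/- For $n\in\mathbb N=\{1,2,\dots\}$ and integrable $f:[0,1]\to\mathbb R$ let $$K_nf(x)=(n+1)\sum_{k=0}^n \binom nk x^k(1-x)^{n-k}\int_{k/(n+1)}^{(k+1)/(n+1)} f(t)\,dt,\qquad x\in[0,1],$$ be the Kantorovich operator. For $f:[0,1]\to\mathbb R$ of bounded variation, $x\in(0,1)$ and $\delta>0$, let $f(x-)$, $f(x+)$ be the one-sided limits of $f$ at $x$, let $\|f\|_\infty=\sup_{t\in[0,1]}|f(t)|$, and let $$\Omega(f,x,\delta)=\max\Big\{\sup_{t\in[x-\delta,x)\cap[0,1]}|f(x-)-f(t)|,\ \sup_{t\in(x,x+\delta]\cap[0,1]}|f(x+)-f(t)|\Big\}.$$ Then the following hold. (a) For all $x\in(0,1)$ and $n\in\mathbb N$, $$\big|K_n(\operatorname{sign}(\cdot-x))(x)\big|\le\frac{12}{\sqrt{nx(1-x)}},$$ where $\operatorname{sign}(t)=1,0,-1$ for $t>0$, $t=0$, $t<0$ respectively. (b) Let $f:[0,1]\to\mathbb R$ be of bounded variation and $x\in(0,1)$. Then (i) for all $\delta>0$ and $n\in\mathbb N$, $$\left|K_nf(x)-\tfrac12\big[f(x+)+f(x-)\big]\right|\le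 2\,\Omega(f,x,\delta)+\|f\|_\infty\left(\frac1{n\delta^2}+\frac{12}{\sqrt{nx(1-x)}}\right);$$ (ii) $\displaystyle\lim_{n\to\infty}\left|K_nf(x)-\tfrac12\big[f(x+)+f(x-)\big]\right|=0.$ -/

import Mathlib

open Set Filter Topology

noncomputable section

/-- The Kantorovich operator of order `n` on functions on `[0,1]`:
`K_n f(x) = (n+1) ∑_{k=0}^n p_{n,k}(x) ∫_{k/(n+1)}^{(k+1)/(n+1)} f(t) dt`, where
`p_{n,k}(x) = (n choose k) x^k (1-x)^(n-k)` is the Bernstein basis polynomial. -/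
def kantorovich (n : ℕ) (f : ℝ → ℝ) (x : ℝ) : ℝ :=
  ((n : ℝ) + 1) * ∑ k ∈ Finset.range (n + 1),
    (bernsteinPolynomial ℝ n k).eval x *
      ∫ t in ((k : ℝ) / ((n : ℝ) + 1))..(((k : ℝ) + 1) / ((n : ℝ) + 1)), f t

/-- The supremum norm `‖f‖_∞ = sup_{t ∈ [0,1]} |f t|`. -/
def supNorm01 (f : ℝ → ℝ) : ℝ :=
  sSup ((fun t => |f t|) '' Icc (0 : ℝ) 1)

/-- The left local quasi-modulus of `f` on `[0,1]` at `x`: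
`sup { |f(x-) - f(t)| : t ∈ [x-δ, x) ∩ [0,1] }`. -/
def leftQuasiModulus (f : ℝ → ℝ) (x δ : ℝ) : ℝ :=
  sSup ((fun t => |Function.leftLim f x - f t|) '' (Ico (x - δ) x ∩ Icc 0 1))

/-- The right local quasi-modulus of `f` on `[0,1]` at `x`:
`sup { |f(x+) - f(t)| : t ∈ (x, x+δ] ∩ [0,1] }`. -/
def rightQuasiModulus (f : ℝ → ℝ) (x δ : ℝ) : ℝ :=
  sSup ((fun t => |Function.rightLim f x - f t|) '' (Ioc x (x + δ) ∩ Icc 0 1))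

/-- The local quasi-modulus `Ω(f,x,δ)`, the maximum of the two one-sided quasi-moduli. -/
def quasiModulus (f : ℝ → ℝ) (x δ : ℝ) : ℝ :=
  max (leftQuasiModulus f x δ) (rightQuasiModulus f x δ)

/-! Well-definedness: for `f` of bounded variation on `[0,1]` the one-sided limits exist, `f` is bounded,
and `f` is integrable, so none of the quantities above takes a junk value. -/

theorem tendsto_leftLim_of_bv {f : ℝ → ℝ} (hf : BoundedVariationOn f (Icc (0 : ℝ) 1)) {x : ℝ}
    (hx : x ∈ Ioo (0 : ℝ) 1) : Tendsto f (𝓝[<] x) (𝓝 (Function.leftLim f x)) := by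
  obtain ⟨l, hl⟩ := hf.exists_tendsto_left x
  apply tendsto_leftLim_of_tendsto
  rw [inter_comm, nhdsWithin_inter_of_mem' (mem_nhdsWithin_of_mem_nhds (Icc_mem_nhds hx.1 hx.2))] at hl
  exact ⟨l, hl⟩

theorem tendsto_rightLim_of_bv {f : ℝ → ℝ} (hf : BoundedVariationOn f (Icc (0 : ℝ) 1)) {x : ℝ}
    (hx : x ∈ Ioo (0 : ℝ) 1) : Tendsto f (𝓝[>] x) (𝓝 (Function.rightLim f x)) := by
  obtain ⟨l, hl⟩ := hf.exists_tendsto_right x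
  apply tendsto_rightLim_of_tendsto
  rw [inter_comm, nhdsWithin_inter_of_mem' (mem_nhdsWithin_of_mem_nhds (Icc_mem_nhds hx.1 hx.2))] at hl
  exact ⟨l, hl⟩

theorem bddAbove_of_bv {f : ℝ → ℝ} (hf : BoundedVariationOn f (Icc (0 : ℝ) 1)) :
    BddAbove ((fun t => |f t|) '' Icc (0 : ℝ) 1) := by
  refine ⟨(eVariationOn f (Icc 0 1)).toReal + |f 0|, ?_⟩
  rintro _ ⟨t, ht, rfl⟩
  have := hf.dist_le ht (show (0:ℝ) ∈ Icc (0:ℝ) 1 by simp)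
  rw [Real.dist_eq] at this
  have h2 := abs_sub_abs_le_abs_sub (f t) (f 0)
  simp only
  linarith

theorem intervalIntegrable_of_bv {f : ℝ → ℝ} (hf : BoundedVariationOn f (Icc (0 : ℝ) 1)) :
    IntervalIntegrable f MeasureTheory.volume 0 1 := by
  obtain ⟨p, q, hp, hq, rfl⟩ := hf.locallyBoundedVariationOn.exists_monotoneOn_sub_monotoneOn
  have e : uIcc (0 : ℝ) 1 = Icc 0 1 := uIcc_of_le zero_le_one
  exact (MonotoneOn.intervalIntegrable (e ▸ hp)).sub (MonotoneOn.intervalIntegrable (e ▸ hq))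

end

/-! Off `x`, `f` is the mean of its one-sided limits, plus half the jump times `sign (t - x)`, plus
a remainder. Within `δ` of `x` the remainder is at most `Ω`; farther out it is at most `2‖f‖ ≤ 2‖f‖
(t - x)² / δ²`. A second moment of at most `1/(2n)` then yields `‖f‖/(nδ²)`, and half the jump is at
most `‖f‖`, so everything reduces to the sign function. There, all cells except the one containing
`x` have mean exactly `±1`, so `K_n sign` compares the binomial masses on the two sides of `(n+1)x`.
The median bounds `binomial_median_upper` and `binomial_median_lower` fix the sign of such a
difference for a cut slightly off `(n+1)x`. Moving the cut back costs twice the weights of two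
cells, hence at most four mode weights, each at most `3/σ` with `σ = √(nx(1-x))`
(`binomialWeight_mode_le`). -/

noncomputable section

/-! ### Binomial weights and their moments -/

/-- The binomial weight `p_{n,k}(x) = (n choose k) x^k (1-x)^(n-k)`. -/
def binomialWeight (n : ℕ) (x : ℝ) (k : ℕ) : ℝ := (bernsteinPolynomial ℝ n k).eval x

theorem binomialWeight_eq (n : ℕ) (x : ℝ) (k : ℕ) :
    binomialWeight n x k = (n.choose k : ℝ) * x ^ k * (1 - x) ^ (n - k) := by
  simp [binomialWeight, bernsteinPolynomial]

theorem binomialWeight_nonneg (n : ℕ) {x : ℝ} (hx : x ∈ Ioo (0 : ℝ) 1) (k : ℕ) :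
    0 ≤ binomialWeight n x k := by
  rw [binomialWeight_eq]
  have := hx.1
  have : 0 < 1 - x := sub_pos.2 hx.2
  positivity

theorem binomialWeight_pos {n : ℕ} {x : ℝ} (hx : x ∈ Ioo (0 : ℝ) 1) {k : ℕ} (hk : k ≤ n) :
    0 < binomialWeight n x k := by
  rw [binomialWeight_eq]
  have := hx.1
  have : 0 < 1 - x := sub_pos.2 hx.2
  have := Nat.choose_pos hk
  positivity

theorem binomialWeight_eq_zero {n k : ℕ} (x : ℝ) (hk : n < k) : binomialWeight n x k = 0 := by
  simp [binomialWeight_eq, Nat.choose_eq_zero_of_lt hk]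

theorem binomialWeight_flip {n k : ℕ} (x : ℝ) (hk : k ≤ n) :
    binomialWeight n (1 - x) k = binomialWeight n x (n - k) := by
  rw [binomialWeight_eq, binomialWeight_eq, Nat.choose_symm hk, Nat.sub_sub_self hk]
  ring

/-- The ratio of consecutive weights, cleared of denominators so that it holds for every `k`; both
sides vanish once `k ≥ n`. -/
theorem binomialWeight_succ (n : ℕ) (x : ℝ) (k : ℕ) :
    ((k : ℝ) + 1) * (1 - x) * binomialWeight n x (k + 1)
      = ((n : ℝ) - k) * x * binomialWeight n x k := by
  rcases lt_trichotomy k n with h | rfl | h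
  · have h1 : ((n.choose (k + 1) : ℕ) : ℝ) * ((k : ℝ) + 1) = n.choose k * ((n : ℝ) - k) := by
      rw [← Nat.cast_sub h.le]
      exact_mod_cast Nat.choose_succ_right_eq n k
    obtain ⟨d, rfl⟩ := Nat.exists_eq_add_of_lt h
    rw [binomialWeight_eq, binomialWeight_eq, show k + d + 1 - (k + 1) = d by omega,
      show k + d + 1 - k = d + 1 by omega]
    linear_combination x ^ (k + 1) * (1 - x) ^ (d + 1) * h1
  · rw [binomialWeight_eq_zero x (Nat.lt_succ_self k)]
    simp
  · rw [binomialWeight_eq_zero x h, binomialWeight_eq_zero x (Nat.lt_succ_of_lt h)]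
    simp

theorem sum_binomialWeight (n : ℕ) (x : ℝ) :
    ∑ k ∈ Finset.range (n + 1), binomialWeight n x k = 1 := by
  have := congrArg (Polynomial.eval x) (bernsteinPolynomial.sum ℝ n)
  simpa [Polynomial.eval_finsetSum, ← binomialWeight.eq_1] using this

theorem sum_mul_binomialWeight (n : ℕ) (x : ℝ) :
    ∑ k ∈ Finset.range (n + 1), (k : ℝ) * binomialWeight n x k = n * x := by
  have := congrArg (Polynomial.eval x) (bernsteinPolynomial.sum_smul ℝ n)
  simpa [Polynomial.eval_finsetSum, ← binomialWeight.eq_1] using this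

theorem sum_sq_binomialWeight (n : ℕ) (x : ℝ) :
    ∑ k ∈ Finset.range (n + 1), ((n : ℝ) * x - k) ^ 2 * binomialWeight n x k
      = n * x * (1 - x) := by
  have := congrArg (Polynomial.eval x) (bernsteinPolynomial.variance ℝ n)
  simpa [Polynomial.eval_finsetSum, ← binomialWeight.eq_1] using this

/-! ### Median bounds for the binomial distribution -/

/-- A finite sequence which, once positive, stays nonnegative, and whose first moment about a
point left of the index range is nonpositive, has nonpositive sum. -/
theorem sum_nonpos_of_sign_change {d : ℕ → ℝ} {N : ℕ}
    (hd : ∀ j, 0 < d j → ∀ i, j ≤ i → 0 ≤ d i)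
    (hm : ∑ j ∈ Finset.range N, ((j : ℝ) + 1 / 2) * d j ≤ 0) :
    ∑ j ∈ Finset.range N, d j ≤ 0 := by
  classical
  by_cases h : ∃ j, 0 < d j
  · have hJ := Nat.find_spec h
    have hmin : ∀ i < Nat.find h, d i ≤ 0 := fun i hi => not_lt.1 (Nat.find_min h hi)
    set J := Nat.find h
    -- Pivot at the first positive index `J`: `(j - J) * d j ≥ 0` for every `j`.
    have h1 : ((J : ℝ) + 1 / 2) * ∑ j ∈ Finset.range N, d j
        ≤ ∑ j ∈ Finset.range N, ((j : ℝ) + 1 / 2) * d j := by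
      rw [Finset.mul_sum]
      refine Finset.sum_le_sum fun j _ => ?_
      rcases lt_or_ge j J with hj | hj
      · have : (j : ℝ) ≤ J := by exact_mod_cast hj.le
        exact mul_le_mul_of_nonpos_right (by linarith) (hmin j hj)
      · have : (J : ℝ) ≤ j := by exact_mod_cast hj
        exact mul_le_mul_of_nonneg_right (by linarith) (hd J hJ j hj)
    have h2 : (0 : ℝ) < (J : ℝ) + 1 / 2 := by positivity
    exact nonpos_of_mul_nonpos_right (h1.trans hm) h2
  · push Not at h
    exact Finset.sum_nonpos fun j _ => h j

/-- Cross-ratio of binomial weights reflected about `c - 1/2`. -/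
theorem binomialWeight_reflect_succ (n : ℕ) (x : ℝ) {c j : ℕ} (hj : j + 2 ≤ c) :
    ((c : ℝ) ^ 2 - ((j : ℝ) + 1) ^ 2) * (1 - x) ^ 2 *
        (binomialWeight n x (c + (j + 1)) * binomialWeight n x (c - 1 - j))
      = (((n : ℝ) + 1 - c) ^ 2 - ((j : ℝ) + 1) ^ 2) * x ^ 2 *
        (binomialWeight n x (c + j) * binomialWeight n x (c - 1 - (j + 1))) := by
  obtain ⟨e, rfl⟩ := Nat.exists_eq_add_of_le hj
  have h1 := binomialWeight_succ n x (j + 2 + e + j)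
  have h2 := binomialWeight_succ n x e
  rw [show j + 2 + e - 1 - j = e + 1 by omega, show j + 2 + e - 1 - (j + 1) = e by omega,
    ← add_assoc (j + 2 + e) j 1]
  push_cast at h1 ⊢
  linear_combination ((e : ℝ) + 1) * (1 - x) * binomialWeight n x (e + 1) * h1 +
    ((n : ℝ) - (j + 2 + e + j)) * x * binomialWeight n x (j + 2 + e + j) * h2

theorem binomialWeight_reflect_zero {n : ℕ} {x : ℝ} (hx : x ∈ Ioo (0 : ℝ) 1) {c : ℕ}
    (hc0 : 1 ≤ c) (hc : ((n : ℝ) + 1) * x ≤ c) :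
    binomialWeight n x c ≤ binomialWeight n x (c - 1) := by
  obtain ⟨k, rfl⟩ := Nat.exists_eq_add_of_le' hc0
  have h := binomialWeight_succ n x k
  have hp : 0 < ((k : ℝ) + 1) * (1 - x) := mul_pos (by positivity) (sub_pos.2 hx.2)
  have h0 := binomialWeight_nonneg n hx k
  push_cast at hc
  rw [Nat.add_sub_cancel]
  refine le_of_mul_le_mul_left ?_ hp
  rw [h]
  exact mul_le_mul_of_nonneg_right (by nlinarith) h0

/-- Once the weights above `c` exceed the reflected weights below `c`, they continue to do so. -/
theorem binomialWeight_reflect_lt {n : ℕ} {x : ℝ} (hx : x ∈ Ioo (0 : ℝ) 1) {c : ℕ}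
    (hc0 : 1 ≤ c) (hcn : c ≤ n + 1) (hc : ((n : ℝ) + 1) * x ≤ c) {j i : ℕ} (hji : j ≤ i)
    (hi : i < c) (h : binomialWeight n x (c - 1 - j) < binomialWeight n x (c + j)) :
    binomialWeight n x (c - 1 - i) < binomialWeight n x (c + i) := by
  set u : ℕ → ℝ := fun j => binomialWeight n x (c + j) with hu
  set v : ℕ → ℝ := fun j => binomialWeight n x (c - 1 - j) with hv
  have hu0 : ∀ j, 0 ≤ u j := fun j => binomialWeight_nonneg n hx _
  have hv0 : ∀ j, 0 < v j := fun j => binomialWeight_pos hx (by omega)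
  -- By `hrec`, the ratio `u / v` grows from `j` to `j + 1` when `D (j + 1) ≥ 0` and shrinks when `D
  -- (j + 1) ≤ 0`.
  set D : ℕ → ℝ := fun i => (((n : ℝ) + 1 - c) ^ 2 - (i : ℝ) ^ 2) * x ^ 2
    - ((c : ℝ) ^ 2 - (i : ℝ) ^ 2) * (1 - x) ^ 2 with hD
  have hx1 : 0 < 1 - x := sub_pos.2 hx.2
  have hG : ∀ j : ℕ, j + 2 ≤ c → 0 < ((c : ℝ) ^ 2 - ((j : ℝ) + 1) ^ 2) * (1 - x) ^ 2 := by
    intro j hj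
    have : (j : ℝ) + 2 ≤ c := by exact_mod_cast hj
    have h2 : 0 < (c : ℝ) ^ 2 - ((j : ℝ) + 1) ^ 2 := by nlinarith [Nat.cast_nonneg (α := ℝ) j]
    positivity
  have hrec : ∀ j : ℕ, j + 2 ≤ c → ((c : ℝ) ^ 2 - ((j : ℝ) + 1) ^ 2) * (1 - x) ^ 2 *
      (u (j + 1) * v j - u j * v (j + 1)) = D (j + 1) * (u j * v (j + 1)) := by
    intro j hj
    have := binomialWeight_reflect_succ n x hj
    simp only [hD, hu, hv]
    push_cast
    linear_combination this
  have hle : ∀ j : ℕ, j + 2 ≤ c → D (j + 1) ≤ 0 → u j ≤ v j → u (j + 1) ≤ v (j + 1) := by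
    intro j hj hDj huv
    have h1 : u (j + 1) * v j - u j * v (j + 1) ≤ 0 := by
      refine nonpos_of_mul_nonpos_right ?_ (hG j hj)
      rw [hrec j hj]
      exact mul_nonpos_of_nonpos_of_nonneg hDj (mul_nonneg (hu0 j) (hv0 _).le)
    refine le_of_mul_le_mul_right ?_ (hv0 j)
    nlinarith [hv0 (j + 1)]
  have h0 : u 0 ≤ v 0 := binomialWeight_reflect_zero hx hc0 hc
  rcases le_total x (1 / 2) with hxh | hxh
  -- `D` is affine in `i²` with slope `1 - 2x ≥ 0`, so `u / v` first falls, then rises. Starting at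
  -- most `1`, it can pass `1` only in the rising phase.
  · have hDmono : ∀ i, 0 ≤ D i → 0 ≤ D (i + 1) := by
      intro i hi
      have : D (i + 1) - D i = (2 * (i : ℝ) + 1) * (1 - 2 * x) := by
        simp only [hD]; push_cast; ring
      have h2 : 0 ≤ (2 * (i : ℝ) + 1) * (1 - 2 * x) :=
        mul_nonneg (by positivity) (by linarith)
      linarith
    have hinv : ∀ j, j < c → u j ≤ v j ∨ 0 ≤ D j := by
      intro j
      induction j with
      | zero => exact fun _ => Or.inl h0
      | succ j ih =>
        intro hj
        rcases ih (by omega) with h1 | h1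
        · rcases le_total (D (j + 1)) 0 with h2 | h2
          · exact Or.inl (hle j hj h2 h1)
          · exact Or.inr h2
        · exact Or.inr (hDmono j h1)
    induction i, hji using Nat.le_induction with
    | base => exact h
    | succ i hji ih =>
      have hlt : v i < u i := ih (by omega)
      have hDi : 0 ≤ D (i + 1) :=
        hDmono i ((hinv i (by omega)).resolve_left (not_le.2 hlt))
      have h1 : 0 ≤ u (i + 1) * v i - u i * v (i + 1) := by
        refine nonneg_of_mul_nonneg_right ?_ (hG i hi)
        rw [hrec i hi]
        exact mul_nonneg hDi (mul_nonneg (hu0 i) (hv0 _).le)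
      change v (i + 1) < u (i + 1)
      refine lt_of_mul_lt_mul_right ?_ (hv0 i).le
      nlinarith [hv0 (i + 1)]
  -- Here the slope is nonpositive and `D 0 ≤ 0`, so `u / v` never exceeds `1` and the hypothesis
  -- `h` is impossible.
  · have hDle : ∀ i, D i ≤ 0 := by
      intro i
      have h1 : ((n : ℝ) + 1 - c) * x ≤ c * (1 - x) := by linarith
      have h2 : (0 : ℝ) ≤ ((n : ℝ) + 1 - c) * x := by
        have : (c : ℝ) ≤ n + 1 := by exact_mod_cast hcn
        exact mul_nonneg (by linarith) hx.1.le
      have h3 := pow_le_pow_left₀ h2 h1 2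
      have h4 : 0 ≤ (i : ℝ) ^ 2 * (2 * x - 1) := mul_nonneg (by positivity) (by linarith)
      simp only [hD]
      nlinarith
    have hall : ∀ j, j < c → u j ≤ v j := by
      intro j
      induction j with
      | zero => exact fun _ => h0
      | succ j ih => exact fun hj => hle j hj (hDle _) (ih (by omega))
    exact absurd h (not_lt.2 (hall j (by omega)))

/-- Splitting a sum at `c` and reflecting the lower part. -/
theorem sum_range_add_reflect (g : ℕ → ℝ) {c N : ℕ} (hc : c ≤ N) :
    ∑ k ∈ Finset.range (c + N), g k = ∑ j ∈ Finset.range N,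
      (g (c + j) + if j < c then g (c - 1 - j) else 0) := by
  rw [Finset.sum_range_add, Finset.sum_add_distrib, add_comm, ← Finset.sum_range_reflect g c,
    ← Finset.sum_filter]
  congr 1
  refine Finset.sum_congr ?_ fun _ _ => rfl
  ext j
  simp only [Finset.mem_range, Finset.mem_filter]
  omega

/-- Padding with zero weights makes room for a reflection about `c - 1/2`, whatever the position of
`c`. -/
theorem sum_range_eq_of_binomialWeight (n : ℕ) (x : ℝ) (g : ℕ → ℝ) (c : ℕ) :
    ∑ k ∈ Finset.range (c + (n + 1)), g k * binomialWeight n x k =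
      ∑ k ∈ Finset.range (n + 1), g k * binomialWeight n x k := by
  symm
  refine Finset.sum_subset (by intro k; simp only [Finset.mem_range]; omega) ?_
  intro k _ hk
  rw [binomialWeight_eq_zero x (by simpa using hk), mul_zero]

/-- An upper median bound for the binomial distribution. -/
theorem binomial_median_upper {n : ℕ} {x : ℝ} (hx : x ∈ Ioo (0 : ℝ) 1) {c : ℕ}
    (hcn : c ≤ n + 1) (hc : ((n : ℝ) + 1) * x + 1 ≤ c) :
    ∑ k ∈ Finset.range (n + 1), (if k < c then -1 else 1) * binomialWeight n x k ≤ 0 := by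
  have hc0 : 1 ≤ c := by
    have : (0 : ℝ) < ((n : ℝ) + 1) * x := mul_pos (by positivity) hx.1
    have : (0 : ℝ) < c := by linarith
    exact_mod_cast this
  set d : ℕ → ℝ := fun j => binomialWeight n x (c + j)
    - (if j < c then binomialWeight n x (c - 1 - j) else 0) with hd
  have e1 : ∑ k ∈ Finset.range (n + 1), (if k < c then (-1 : ℝ) else 1) * binomialWeight n x k
      = ∑ j ∈ Finset.range (n + 1), d j := by
    rw [← sum_range_eq_of_binomialWeight n x _ c, sum_range_add_reflect _ hcn]
    refine Finset.sum_congr rfl fun j _ => ?_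
    rw [if_neg (by omega), if_pos (by omega : c - 1 - j < c)]
    simp only [hd]
    split_ifs <;> ring
  -- The first moment about the centre of reflection is `nx - c + 1/2`, which the hypothesis on `c`
  -- makes negative.
  have e2 : ∑ k ∈ Finset.range (n + 1), ((k : ℝ) - c + 1 / 2) * binomialWeight n x k
      = ∑ j ∈ Finset.range (n + 1), ((j : ℝ) + 1 / 2) * d j := by
    rw [← sum_range_eq_of_binomialWeight n x _ c, sum_range_add_reflect _ hcn]
    refine Finset.sum_congr rfl fun j _ => ?_
    simp only [hd]
    split_ifs with h
    · have : ((c - 1 - j : ℕ) : ℝ) = (c : ℝ) - 1 - j := by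
        rw [Nat.cast_sub (by omega), Nat.cast_sub hc0, Nat.cast_one]
      rw [this]
      push_cast
      ring
    · push_cast
      ring
  have e3 : ∑ k ∈ Finset.range (n + 1), ((k : ℝ) - c + 1 / 2) * binomialWeight n x k
      = n * x - c + 1 / 2 := by
    rw [← sum_mul_binomialWeight n x]
    have : ∑ k ∈ Finset.range (n + 1), (-(c : ℝ) + 1 / 2) * binomialWeight n x k
        = -(c : ℝ) + 1 / 2 := by
      rw [← Finset.mul_sum, sum_binomialWeight, mul_one]
    rw [sub_add, sub_eq_add_neg, neg_sub, sub_eq_neg_add, ← this, ← Finset.sum_add_distrib]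
    exact Finset.sum_congr rfl fun k _ => by ring
  rw [e1]
  refine sum_nonpos_of_sign_change ?_ ?_
  · intro j hj i hji
    simp only [hd] at hj ⊢
    by_cases hi : i < c
    · rw [if_pos (by omega)] at hj
      rw [if_pos hi]
      exact (sub_pos.2 (binomialWeight_reflect_lt hx hc0 hcn (by linarith) hji hi
        (sub_pos.1 hj))).le
    · rw [if_neg hi, sub_zero]
      exact binomialWeight_nonneg n hx _
  · rw [← e2, e3]
    have := hx.1
    nlinarith

/-- A lower median bound for the binomial distribution. -/
theorem binomial_median_lower {n : ℕ} {x : ℝ} (hx : x ∈ Ioo (0 : ℝ) 1) {c : ℕ}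
    (hc : (c : ℝ) + 1 ≤ ((n : ℝ) + 1) * x) :
    0 ≤ ∑ k ∈ Finset.range (n + 1), (if k < c then -1 else 1) * binomialWeight n x k := by
  have hcn : c ≤ n + 1 := by
    have : (c : ℝ) ≤ (n + 1 : ℕ) := by push_cast; nlinarith [hx.2, Nat.cast_nonneg (α := ℝ) n]
    exact_mod_cast this
  -- Exchange successes and failures: `x ↦ 1 - x`, `k ↦ n - k`, `c ↦ n + 1 - c`.
  have h := binomial_median_upper (n := n) (x := 1 - x) ⟨sub_pos.2 hx.2, by linarith [hx.1]⟩
    (c := n + 1 - c) (by omega) (by rw [Nat.cast_sub hcn]; push_cast; linarith)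
  rw [← Finset.sum_range_reflect, ← neg_nonneg, ← Finset.sum_neg_distrib] at h
  refine h.trans_eq (Finset.sum_congr rfl fun k hk => ?_)
  have hk : k < n + 1 := Finset.mem_range.1 hk
  rw [binomialWeight_flip x (by omega), show n - (n + 1 - 1 - k) = k by omega]
  by_cases hkc : k < c
  · rw [if_pos hkc, if_neg (by omega)]; ring
  · rw [if_neg hkc, if_pos (by omega)]; ring

/-! ### Size of the mode weight -/

theorem sum_binomialWeight_shift_le_one {n : ℕ} {x : ℝ} (hx : x ∈ Ioo (0 : ℝ) 1) (m J : ℕ) :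
    ∑ j ∈ Finset.range J, binomialWeight n x (m + j) ≤ 1 := by
  have h1 := sum_range_eq_of_binomialWeight n x (fun _ => 1) (m + J)
  simp only [one_mul] at h1
  rw [sum_binomialWeight, Finset.sum_range_add, Finset.sum_range_add] at h1
  have h2 : ∀ s : Finset ℕ, ∀ g : ℕ → ℕ, 0 ≤ ∑ k ∈ s, binomialWeight n x (g k) :=
    fun s g => Finset.sum_nonneg fun k _ => binomialWeight_nonneg n hx _
  have h3 := h2 (Finset.range m) fun k => k
  have h4 := h2 (Finset.range (n + 1)) fun k => m + J + k
  linarith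

theorem binomialWeight_sub_succ_bounds {n m : ℕ} {x : ℝ} (hx : x ∈ Ioo (0 : ℝ) 1)
    (hm : (m : ℝ) ≤ ((n : ℝ) + 1) * x) (hm' : ((n : ℝ) + 1) * x < m + 1) (j : ℕ) :
    binomialWeight n x (m + (j + 1)) ≤ binomialWeight n x (m + j) ∧
    (binomialWeight n x (m + j) - binomialWeight n x (m + (j + 1))) * ((n : ℝ) * x * (1 - x))
      ≤ ((j : ℝ) + 1) * binomialWeight n x (m + j) := by
  have h := binomialWeight_succ n x (m + j)
  have hp := binomialWeight_nonneg n hx (m + j)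
  rw [← add_assoc]
  set p := binomialWeight n x (m + j)
  set q := binomialWeight n x (m + j + 1)
  push_cast at h
  have hx1 : 0 < 1 - x := sub_pos.2 hx.2
  have hj : (0 : ℝ) ≤ j := Nat.cast_nonneg j
  have hQ : 0 < ((m : ℝ) + j + 1) * (1 - x) := mul_pos (by positivity) hx1
  have key : ((m : ℝ) + j + 1) * (1 - x) * (p - q) = ((m : ℝ) + j + 1 - ((n : ℝ) + 1) * x) * p := by
    linear_combination -h
  have hqp : 0 ≤ p - q := by
    refine nonneg_of_mul_nonneg_right ?_ hQ
    rw [key]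
    exact mul_nonneg (by linarith) hp
  refine ⟨sub_nonneg.1 hqp, ?_⟩
  -- The denominator of the relative drop is at least the variance, as `m + 1 > (n+1)x > nx`.
  have h1 : (n : ℝ) * x * (1 - x) ≤ ((m : ℝ) + j + 1) * (1 - x) :=
    mul_le_mul_of_nonneg_right (by linarith [hx.1]) hx1.le
  calc (p - q) * ((n : ℝ) * x * (1 - x)) ≤ (p - q) * (((m : ℝ) + j + 1) * (1 - x)) :=
        mul_le_mul_of_nonneg_left h1 hqp
    _ = ((m : ℝ) + j + 1 - ((n : ℝ) + 1) * x) * p := by rw [mul_comm, key]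
    _ ≤ ((j : ℝ) + 1) * p := mul_le_mul_of_nonneg_right (by linarith) hp

/-- Summing the one-step drops, each at most `(i + 1) / σ²` times the mode weight, gives the
triangular number. -/
theorem binomialWeight_mode_decay {n m : ℕ} {x : ℝ} (hx : x ∈ Ioo (0 : ℝ) 1)
    (hm : (m : ℝ) ≤ ((n : ℝ) + 1) * x) (hm' : ((n : ℝ) + 1) * x < m + 1) (j : ℕ) :
    binomialWeight n x (m + j) ≤ binomialWeight n x m ∧
    (binomialWeight n x m - binomialWeight n x (m + j)) * ((n : ℝ) * x * (1 - x))
      ≤ (j : ℝ) * ((j : ℝ) + 1) / 2 * binomialWeight n x m := by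
  induction j with
  | zero => simp
  | succ j ih =>
    obtain ⟨h1, h2⟩ := binomialWeight_sub_succ_bounds hx hm hm' j
    refine ⟨h1.trans ih.1, ?_⟩
    have h3 := mul_le_mul_of_nonneg_left ih.1 (by positivity : (0 : ℝ) ≤ (j : ℝ) + 1)
    push_cast
    nlinarith [ih.2]

/-- The mode weight is at most `3 / √(n x (1-x))` once the standard deviation is at least `12`. -/
theorem binomialWeight_mode_le {n m : ℕ} {x : ℝ} (hx : x ∈ Ioo (0 : ℝ) 1)
    (hm : (m : ℝ) ≤ ((n : ℝ) + 1) * x) (hm' : ((n : ℝ) + 1) * x < m + 1)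
    (hσ : 12 ≤ Real.sqrt ((n : ℝ) * x * (1 - x))) :
    binomialWeight n x m ≤ 3 / Real.sqrt ((n : ℝ) * x * (1 - x)) := by
  have hS0 : 0 ≤ (n : ℝ) * x * (1 - x) :=
    mul_nonneg (mul_nonneg (by positivity) hx.1.le) (sub_nonneg.2 hx.2.le)
  have hsq := Real.sq_sqrt hS0
  set σ := Real.sqrt ((n : ℝ) * x * (1 - x))
  have hp := binomialWeight_nonneg n hx m
  set p := binomialWeight n x m
  have hσ0 : 0 < σ := by linarith
  have hJ := Nat.floor_le hσ0.le
  have hJ' := Nat.lt_floor_add_one σ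
  set J := ⌊σ⌋₊
  -- Up to distance `σ` the weights stay above half the mode, so total mass `1` forces `J * p / 2 ≤
  -- 1`. With `σ ≥ 12`, `J > 11σ/12` and `p ≤ 24/(11σ) < 3/σ`.
  have hhalf : ∀ j ∈ Finset.range J, p / 2 ≤ binomialWeight n x (m + j) := by
    intro j hj
    have hjJ : (j : ℝ) + 1 ≤ J := by exact_mod_cast Finset.mem_range.1 hj
    have h := (binomialWeight_mode_decay hx hm hm' j).2
    rw [← hsq] at h
    have h1 : (j : ℝ) * ((j : ℝ) + 1) ≤ σ ^ 2 := by
      nlinarith [Nat.cast_nonneg (α := ℝ) j]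
    have h2 : (j : ℝ) * ((j : ℝ) + 1) / 2 * p ≤ p / 2 * σ ^ 2 := by
      nlinarith
    have h3 := le_of_mul_le_mul_right (h.trans h2) (by positivity)
    linarith
  have hsum := (Finset.sum_le_sum hhalf).trans (sum_binomialWeight_shift_le_one hx m J)
  rw [Finset.sum_const, Finset.card_range, nsmul_eq_mul] at hsum
  rw [le_div_iff₀ hσ0]
  nlinarith

theorem binomialWeight_pred_mode_le {n m : ℕ} {x : ℝ} (hx : x ∈ Ioo (0 : ℝ) 1)
    (hm : ((m : ℝ) + 1) ≤ ((n : ℝ) + 1) * x) :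
    binomialWeight n x m ≤ binomialWeight n x (m + 1) := by
  have h := binomialWeight_succ n x m
  have hp := binomialWeight_nonneg n hx m
  have hQ : 0 < ((m : ℝ) + 1) * (1 - x) := mul_pos (by positivity) (sub_pos.2 hx.2)
  refine le_of_mul_le_mul_left ?_ hQ
  rw [h]
  exact mul_le_mul_of_nonneg_right (by linarith) hp

/-! ### Cell means and the sign function -/

/-- The mean of `f` over the `k`-th cell `[k/(n+1), (k+1)/(n+1)]`. -/
def cellMean (n : ℕ) (f : ℝ → ℝ) (k : ℕ) : ℝ :=
  ((n : ℝ) + 1) * ∫ t in ((k : ℝ) / ((n : ℝ) + 1))..(((k : ℝ) + 1) / ((n : ℝ) + 1)), f t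

theorem kantorovich_eq_sum_cellMean (n : ℕ) (f : ℝ → ℝ) (x : ℝ) :
    kantorovich n f x = ∑ k ∈ Finset.range (n + 1), cellMean n f k * binomialWeight n x k := by
  rw [kantorovich, Finset.mul_sum]
  refine Finset.sum_congr rfl fun k _ => ?_
  rw [cellMean, binomialWeight]
  ring

theorem cell_le (n k : ℕ) : (k : ℝ) / ((n : ℝ) + 1) ≤ ((k : ℝ) + 1) / ((n : ℝ) + 1) := by
  gcongr
  linarith

theorem cell_subset {n k : ℕ} (hk : k ∈ Finset.range (n + 1)) :
    uIcc ((k : ℝ) / ((n : ℝ) + 1)) (((k : ℝ) + 1) / ((n : ℝ) + 1)) ⊆ Icc 0 1 := by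
  rw [uIcc_of_le (cell_le n k)]
  refine Icc_subset_Icc (by positivity) ?_
  rw [div_le_one (by positivity)]
  exact_mod_cast Finset.mem_range.1 hk

theorem cellMean_const (n k : ℕ) (C : ℝ) : cellMean n (fun _ => C) k = C := by
  rw [cellMean, intervalIntegral.integral_const, smul_eq_mul]
  field_simp
  ring

theorem cellMean_mono {n k : ℕ} {f g : ℝ → ℝ}
    (hf : IntervalIntegrable f MeasureTheory.volume ((k : ℝ) / ((n : ℝ) + 1))
      (((k : ℝ) + 1) / ((n : ℝ) + 1)))
    (hg : IntervalIntegrable g MeasureTheory.volume ((k : ℝ) / ((n : ℝ) + 1))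
      (((k : ℝ) + 1) / ((n : ℝ) + 1)))
    (h : ∀ t ∈ Ioo ((k : ℝ) / ((n : ℝ) + 1)) (((k : ℝ) + 1) / ((n : ℝ) + 1)), f t ≤ g t) :
    cellMean n f k ≤ cellMean n g k :=
  mul_le_mul_of_nonneg_left
    (intervalIntegral.integral_mono_on_of_le_Ioo (cell_le n k) hf hg h) (by positivity)

theorem monotone_sign : Monotone Real.sign := by
  intro a b hab
  rcases lt_trichotomy a 0 with ha | rfl | ha
  · rw [Real.sign_of_neg ha]
    rcases Real.sign_apply_eq b with h | h | h <;> rw [h] <;> norm_num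
  · rcases hab.eq_or_lt with rfl | hb
    · rfl
    · rw [Real.sign_of_pos hb, Real.sign_zero]; norm_num
  · rw [Real.sign_of_pos ha, Real.sign_of_pos (ha.trans_le hab)]

theorem abs_sign_le_one (a : ℝ) : |Real.sign a| ≤ 1 := by
  rcases Real.sign_apply_eq a with h | h | h <;> rw [h] <;> norm_num

theorem intervalIntegrable_sign_sub (x a b : ℝ) :
    IntervalIntegrable (fun t => Real.sign (t - x)) MeasureTheory.volume a b :=
  Monotone.intervalIntegrable fun _ _ h => monotone_sign (sub_le_sub_right h x)

theorem cellMean_sign_le_one (n k : ℕ) (x : ℝ) :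
    cellMean n (fun t => Real.sign (t - x)) k ≤ 1 := by
  rw [← cellMean_const n k 1]
  exact cellMean_mono (intervalIntegrable_sign_sub _ _ _) intervalIntegrable_const
    fun t _ => (abs_le.1 (abs_sign_le_one _)).2

theorem neg_one_le_cellMean_sign (n k : ℕ) (x : ℝ) :
    -1 ≤ cellMean n (fun t => Real.sign (t - x)) k := by
  rw [← cellMean_const n k (-1)]
  exact cellMean_mono intervalIntegrable_const (intervalIntegrable_sign_sub _ _ _)
    fun t _ => (abs_le.1 (abs_sign_le_one _)).1

theorem cellMean_sign_le_neg_one {n k : ℕ} {x : ℝ} (hk : (k : ℝ) + 1 ≤ ((n : ℝ) + 1) * x) :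
    cellMean n (fun t => Real.sign (t - x)) k ≤ -1 := by
  rw [← cellMean_const n k (-1)]
  refine cellMean_mono (intervalIntegrable_sign_sub _ _ _) intervalIntegrable_const fun t ht => ?_
  have : ((k : ℝ) + 1) / ((n : ℝ) + 1) ≤ x := by
    rw [div_le_iff₀ (by positivity)]; linarith
  rw [Real.sign_of_neg (by linarith [ht.2])]

theorem one_le_cellMean_sign {n k : ℕ} {x : ℝ} (hk : ((n : ℝ) + 1) * x ≤ k) :
    1 ≤ cellMean n (fun t => Real.sign (t - x)) k := by
  rw [← cellMean_const n k 1]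
  refine cellMean_mono intervalIntegrable_const (intervalIntegrable_sign_sub _ _ _) fun t ht => ?_
  have : x ≤ (k : ℝ) / ((n : ℝ) + 1) := by
    rw [le_div_iff₀ (by positivity)]; linarith
  rw [Real.sign_of_pos (by linarith [ht.1])]

theorem abs_kantorovich_sign_le_one (n : ℕ) {x : ℝ} (hx : x ∈ Ioo (0 : ℝ) 1) :
    |kantorovich n (fun t => Real.sign (t - x)) x| ≤ 1 := by
  rw [kantorovich_eq_sum_cellMean, abs_le]
  have h := sum_binomialWeight n x
  constructor
  · rw [← h, ← Finset.sum_neg_distrib]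
    refine Finset.sum_le_sum fun k _ => ?_
    nlinarith [neg_one_le_cellMean_sign n k x, binomialWeight_nonneg n hx k]
  · rw [← h]
    refine Finset.sum_le_sum fun k _ => ?_
    nlinarith [cellMean_sign_le_one n k x, binomialWeight_nonneg n hx k]

theorem sum_pair_binomialWeight_le {n : ℕ} {x : ℝ} (hx : x ∈ Ioo (0 : ℝ) 1) (m : ℕ) :
    ∑ k ∈ Finset.range (n + 1), (if k = m ∨ k = m + 1 then 2 else 0) * binomialWeight n x k
      ≤ 2 * binomialWeight n x m + 2 * binomialWeight n x (m + 1) := by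
  have h1 : ∀ k, (if k = m ∨ k = m + 1 then (2 : ℝ) else 0) * binomialWeight n x k
      = (if k = m then 2 * binomialWeight n x k else 0)
        + (if k = m + 1 then 2 * binomialWeight n x k else 0) := by
    intro k
    by_cases h : k = m
    · simp [h]
    · by_cases h' : k = m + 1 <;> simp [h, h']
  simp_rw [h1, Finset.sum_add_distrib, Finset.sum_ite_eq']
  have := binomialWeight_nonneg n hx m
  have := binomialWeight_nonneg n hx (m + 1)
  gcongr <;> split_ifs <;> linarith

theorem abs_kantorovich_sign_le {n : ℕ} (hn : 1 ≤ n) {x : ℝ} (hx : x ∈ Ioo (0 : ℝ) 1) :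
    |kantorovich n (fun t => Real.sign (t - x)) x|
      ≤ 12 / Real.sqrt ((n : ℝ) * x * (1 - x)) := by
  have hx1 : 0 < 1 - x := sub_pos.2 hx.2
  have hx0 := hx.1
  have hn0 : (0 : ℝ) < n := by exact_mod_cast hn
  have hS : 0 < (n : ℝ) * x * (1 - x) := by positivity
  have hσ0 := Real.sqrt_pos.2 hS
  -- For `σ ≤ 12` the claimed bound is at least `1`, hence trivial.
  rcases le_total (Real.sqrt ((n : ℝ) * x * (1 - x))) 12 with hσ | hσ
  · refine (abs_kantorovich_sign_le_one n hx).trans ?_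
    rwa [one_le_div hσ0]
  have hm := Nat.floor_le (by positivity : 0 ≤ ((n : ℝ) + 1) * x)
  have hm' := Nat.lt_floor_add_one (((n : ℝ) + 1) * x)
  set m := ⌊((n : ℝ) + 1) * x⌋₊
  have hmode := binomialWeight_mode_le hx hm hm' hσ
  have hnn := binomialWeight_nonneg n hx
  have hm0 : 1 ≤ m := by
    have h144 : (12 : ℝ) ^ 2 ≤ (n : ℝ) * x * (1 - x) := (Real.le_sqrt (by norm_num) hS.le).1 hσ
    have : (n : ℝ) * x * (1 - x) ≤ n * x := by nlinarith [mul_pos hn0 hx0]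
    have : (0 : ℝ) < m := by nlinarith
    exact_mod_cast this
  have hmn : m + 1 ≤ n + 1 := by
    have : (m : ℝ) < n + 1 := hm.trans_lt (by nlinarith)
    exact_mod_cast this
  rw [kantorovich_eq_sum_cellMean, abs_le]
  have h12 : 12 / Real.sqrt ((n : ℝ) * x * (1 - x))
      = 4 * (3 / Real.sqrt ((n : ℝ) * x * (1 - x))) := by ring
  rw [h12]
  constructor
  -- Lower bound: cut at `l = m - 1`, the largest cut `binomial_median_lower` allows. Only cells `l`
  -- and `l + 1` can fall below the step function, by at most `2`.
  · obtain ⟨l, hl⟩ := Nat.exists_eq_add_of_le' hm0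
    rw [hl] at hm hm' hmode
    push_cast at hm hm'
    have h1 := binomial_median_lower hx hm
    have h2 := sum_pair_binomialWeight_le (n := n) hx l
    have h3 := binomialWeight_pred_mode_le hx hm
    have h4 : ∑ k ∈ Finset.range (n + 1), (if k < l then -1 else 1) * binomialWeight n x k
        - ∑ k ∈ Finset.range (n + 1), (if k = l ∨ k = l + 1 then 2 else 0) * binomialWeight n x k
        ≤ ∑ k ∈ Finset.range (n + 1),
          cellMean n (fun t => Real.sign (t - x)) k * binomialWeight n x k := by
      rw [← Finset.sum_sub_distrib]
      refine Finset.sum_le_sum fun k _ => ?_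
      rw [← sub_mul]
      refine mul_le_mul_of_nonneg_right ?_ (hnn k)
      have h5 := neg_one_le_cellMean_sign n k x
      by_cases hk : l + 2 ≤ k
      · have : (l : ℝ) + 2 ≤ k := by exact_mod_cast hk
        have := one_le_cellMean_sign (n := n) (k := k) (x := x) (by linarith)
        rw [if_neg (by omega), if_neg (by omega)]
        linarith
      · by_cases hkl : k < l
        · rw [if_pos hkl, if_neg (by omega)]
          linarith
        · rw [if_neg hkl, if_pos (by omega)]
          linarith
    linarith
  -- Upper bound: cut at `m + 2`, as `binomial_median_upper` needs a cut at least `(n+1)x + 1`. Only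
  -- cells `m` and `m + 1` can exceed the step function.
  · have h3 := (binomialWeight_mode_decay hx hm hm' 1).1
    have h2 := sum_pair_binomialWeight_le (n := n) hx m
    have h4 : ∑ k ∈ Finset.range (n + 1),
          cellMean n (fun t => Real.sign (t - x)) k * binomialWeight n x k
        ≤ ∑ k ∈ Finset.range (n + 1), (if k < m + 2 then -1 else 1) * binomialWeight n x k
        + ∑ k ∈ Finset.range (n + 1),
          (if k = m ∨ k = m + 1 then 2 else 0) * binomialWeight n x k := by
      rw [← Finset.sum_add_distrib]
      refine Finset.sum_le_sum fun k _ => ?_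
      rw [← add_mul]
      refine mul_le_mul_of_nonneg_right ?_ (hnn k)
      have h5 := cellMean_sign_le_one n k x
      by_cases hk : k < m
      · have : (k : ℝ) + 1 ≤ m := by exact_mod_cast hk
        have := cellMean_sign_le_neg_one (n := n) (k := k) (x := x) (by linarith)
        rw [if_pos (by omega), if_neg (by omega)]
        linarith
      · by_cases hkl : k < m + 2
        · rw [if_pos hkl, if_pos (by omega)]
          linarith
        · rw [if_neg hkl, if_neg (by omega)]
          linarith
    have h1 : ∑ k ∈ Finset.range (n + 1), (if k < m + 2 then -1 else 1) * binomialWeight n x k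
        ≤ 0 := by
      by_cases hmn' : m + 2 ≤ n + 1
      · exact binomial_median_upper hx hmn' (by push_cast; linarith)
      -- If the cut lies beyond `n + 1`, every sign in the sum is `-1`.
      · refine Finset.sum_nonpos fun k hk => ?_
        rw [if_pos (by have := Finset.mem_range.1 hk; omega)]
        linarith [hnn k]
    linarith

/-! ### Second central moment -/

theorem cellMean_sub_sq (n k : ℕ) (x : ℝ) :
    cellMean n (fun t => (t - x) ^ 2) k =
      (((n : ℝ) * x - k) ^ 2 - (1 - 2 * x) * ((n : ℝ) * x - k) + (1 / 3 - x * (1 - x)))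
        / ((n : ℝ) + 1) ^ 2 := by
  have hn : (n : ℝ) + 1 ≠ 0 := by positivity
  rw [cellMean, intervalIntegral.integral_comp_sub_right (fun t => t ^ 2) x, integral_pow,
    div_sub' hn, div_sub' hn]
  simp only [Nat.cast_ofNat, Nat.reduceAdd, div_pow]
  field_simp
  ring

/-- The second central moment of the Kantorovich operator. -/
theorem kantorovich_sub_sq (n : ℕ) (x : ℝ) :
    kantorovich n (fun t => (t - x) ^ 2) x =
      ((n : ℝ) * x * (1 - x) + (1 / 3 - x * (1 - x))) / ((n : ℝ) + 1) ^ 2 := by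
  rw [kantorovich_eq_sum_cellMean]
  simp_rw [cellMean_sub_sq, div_mul_eq_mul_div]
  rw [← Finset.sum_div]
  congr 1
  have h0 := sum_binomialWeight n x
  have h1 := sum_mul_binomialWeight n x
  have h2 := sum_sq_binomialWeight n x
  have h3 : ∑ k ∈ Finset.range (n + 1),
      (((n : ℝ) * x - k) ^ 2 - (1 - 2 * x) * ((n : ℝ) * x - k) + (1 / 3 - x * (1 - x)))
        * binomialWeight n x k
      = ∑ k ∈ Finset.range (n + 1), ((n : ℝ) * x - k) ^ 2 * binomialWeight n x k
        + (1 - 2 * x) * ∑ k ∈ Finset.range (n + 1), (k : ℝ) * binomialWeight n x k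
        + (1 / 3 - x * (1 - x) - (1 - 2 * x) * (n * x))
          * ∑ k ∈ Finset.range (n + 1), binomialWeight n x k := by
    rw [Finset.mul_sum, Finset.mul_sum, ← Finset.sum_add_distrib, ← Finset.sum_add_distrib]
    exact Finset.sum_congr rfl fun k _ => by ring
  rw [h3, h0, h1, h2]
  ring

theorem kantorovich_sub_sq_le {n : ℕ} (hn : 1 ≤ n) {x : ℝ} (hx : x ∈ Ioo (0 : ℝ) 1) :
    kantorovich n (fun t => (t - x) ^ 2) x ≤ 1 / (2 * n) := by
  have hn1 : (1 : ℝ) ≤ n := by exact_mod_cast hn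
  have hv : x * (1 - x) ≤ 1 / 4 := by nlinarith [sq_nonneg (2 * x - 1)]
  have hv0 : 0 ≤ x * (1 - x) := mul_nonneg hx.1.le (sub_nonneg.2 hx.2.le)
  rw [kantorovich_sub_sq, div_le_div_iff₀ (by positivity) (by positivity)]
  have h : (n : ℝ) * x * (1 - x) + (1 / 3 - x * (1 - x)) ≤ n / 4 + 1 / 12 := by nlinarith
  nlinarith

/-! ### Jump decomposition and the quantitative estimate -/

/-- The Kantorovich operator respects the splitting of a function into a constant, a multiple
of the sign function and a dominated remainder. -/
theorem abs_kantorovich_sub_le {n : ℕ} {f g : ℝ → ℝ} {x A B : ℝ} (hx : x ∈ Ioo (0 : ℝ) 1)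
    (hf : IntervalIntegrable f MeasureTheory.volume 0 1) (hg : Continuous g)
    (h : ∀ t ∈ Icc (0 : ℝ) 1, t ≠ x → |f t - (A + B * Real.sign (t - x))| ≤ g t) :
    |kantorovich n f x - (A + B * kantorovich n (fun t => Real.sign (t - x)) x)|
      ≤ kantorovich n g x := by
  have hA : A = ∑ k ∈ Finset.range (n + 1), A * binomialWeight n x k := by
    rw [← Finset.mul_sum, sum_binomialWeight, mul_one]
  simp_rw [kantorovich_eq_sum_cellMean]
  rw [hA, Finset.mul_sum, ← Finset.sum_add_distrib, ← Finset.sum_sub_distrib]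
  refine (Finset.abs_sum_le_sum_abs _ _).trans (Finset.sum_le_sum fun k hk => ?_)
  rw [← mul_assoc, ← add_mul, ← sub_mul, abs_mul, abs_of_nonneg (binomialWeight_nonneg n hx k)]
  refine mul_le_mul_of_nonneg_right ?_ (binomialWeight_nonneg n hx k)
  have hsub := cell_subset hk
  have hfk : IntervalIntegrable f MeasureTheory.volume ((k : ℝ) / ((n : ℝ) + 1))
      (((k : ℝ) + 1) / ((n : ℝ) + 1)) :=
    hf.mono_set (by rwa [uIcc_of_le (zero_le_one' ℝ)])
  have hsk := intervalIntegrable_sign_sub x ((k : ℝ) / ((n : ℝ) + 1))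
    (((k : ℝ) + 1) / ((n : ℝ) + 1))
  have hlin : cellMean n f k - (A + B * cellMean n (fun t => Real.sign (t - x)) k)
      = cellMean n (fun t => f t - (A + B * Real.sign (t - x))) k := by
    have hc : A = cellMean n (fun _ => A) k := (cellMean_const n k A).symm
    simp only [cellMean] at hc ⊢
    rw [intervalIntegral.integral_sub hfk (intervalIntegrable_const.add (hsk.const_mul B)),
      intervalIntegral.integral_add intervalIntegrable_const (hsk.const_mul B),
      intervalIntegral.integral_const_mul]
    linear_combination -hc
  rw [hlin, cellMean, cellMean, abs_mul, abs_of_pos (by positivity : (0 : ℝ) < (n : ℝ) + 1)]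
  refine mul_le_mul_of_nonneg_left ?_ (by positivity)
  rw [← Real.norm_eq_abs]
  refine intervalIntegral.norm_integral_le_of_norm_le (cell_le n k) ?_ (hg.intervalIntegrable _ _)
  -- The value `f x` is unrelated to the one-sided limits, but a single point is null.
  have hne : ∀ᵐ t ∂(MeasureTheory.volume : MeasureTheory.Measure ℝ), t ≠ x := by
    simp [MeasureTheory.ae_iff]
  filter_upwards [hne] with t ht htk
  exact h t (hsub (by rw [uIcc_of_le (cell_le n k)]; exact Ioc_subset_Icc_self htk)) ht

theorem abs_le_supNorm01 {f : ℝ → ℝ} (hf : BoundedVariationOn f (Icc (0 : ℝ) 1)) {t : ℝ}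
    (ht : t ∈ Icc (0 : ℝ) 1) : |f t| ≤ supNorm01 f :=
  le_csSup (bddAbove_of_bv hf) ⟨t, ht, rfl⟩

theorem abs_leftLim_le_supNorm01 {f : ℝ → ℝ} (hf : BoundedVariationOn f (Icc (0 : ℝ) 1)) {x : ℝ}
    (hx : x ∈ Ioo (0 : ℝ) 1) : |Function.leftLim f x| ≤ supNorm01 f := by
  refine le_of_tendsto (tendsto_leftLim_of_bv hf hx).abs ?_
  filter_upwards [Ioo_mem_nhdsLT hx.1] with t ht
  exact abs_le_supNorm01 hf ⟨ht.1.le, (ht.2.trans hx.2).le⟩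

theorem abs_rightLim_le_supNorm01 {f : ℝ → ℝ} (hf : BoundedVariationOn f (Icc (0 : ℝ) 1)) {x : ℝ}
    (hx : x ∈ Ioo (0 : ℝ) 1) : |Function.rightLim f x| ≤ supNorm01 f := by
  refine le_of_tendsto (tendsto_rightLim_of_bv hf hx).abs ?_
  filter_upwards [Ioo_mem_nhdsGT hx.2] with t ht
  exact abs_le_supNorm01 hf ⟨(hx.1.trans ht.1).le, ht.2.le⟩

theorem supNorm01_nonneg (f : ℝ → ℝ) : 0 ≤ supNorm01 f :=
  Real.sSup_nonneg (by rintro _ ⟨t, -, rfl⟩; exact abs_nonneg _)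

theorem quasiModulus_nonneg (f : ℝ → ℝ) (x δ : ℝ) : 0 ≤ quasiModulus f x δ :=
  le_max_of_le_left (Real.sSup_nonneg (by rintro _ ⟨t, -, rfl⟩; exact abs_nonneg _))

theorem abs_leftLim_sub_le_quasiModulus {f : ℝ → ℝ} (hf : BoundedVariationOn f (Icc (0 : ℝ) 1))
    {x δ t : ℝ} (htx : t ∈ Ico (x - δ) x) (ht : t ∈ Icc (0 : ℝ) 1) :
    |Function.leftLim f x - f t| ≤ quasiModulus f x δ := by
  refine le_max_of_le_left (le_csSup ⟨|Function.leftLim f x| + supNorm01 f, ?_⟩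
    ⟨t, ⟨htx, ht⟩, rfl⟩)
  rintro _ ⟨s, hs, rfl⟩
  exact (abs_sub _ _).trans (by gcongr; exact abs_le_supNorm01 hf hs.2)

theorem abs_rightLim_sub_le_quasiModulus {f : ℝ → ℝ} (hf : BoundedVariationOn f (Icc (0 : ℝ) 1))
    {x δ t : ℝ} (htx : t ∈ Ioc x (x + δ)) (ht : t ∈ Icc (0 : ℝ) 1) :
    |Function.rightLim f x - f t| ≤ quasiModulus f x δ := by
  refine le_max_of_le_right (le_csSup ⟨|Function.rightLim f x| + supNorm01 f, ?_⟩
    ⟨t, ⟨htx, ht⟩, rfl⟩)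
  rintro _ ⟨s, hs, rfl⟩
  exact (abs_sub _ _).trans (by gcongr; exact abs_le_supNorm01 hf hs.2)

theorem two_mul_le_mul_sq_div {M δ y : ℝ} (hM : 0 ≤ M) (hδ : 0 < δ) (hy : δ ≤ |y|) :
    2 * M ≤ 2 * M / δ ^ 2 * y ^ 2 := by
  rw [div_mul_eq_mul_div, le_div_iff₀ (by positivity)]
  have := pow_le_pow_left₀ hδ.le hy 2
  rw [sq_abs] at this
  gcongr

/-- The subtracted function equals `f(x-)` left of `x` and `f(x+)` right of it. Beyond distance `δ`,
a Chebyshev-type bound replaces the modulus. -/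
theorem abs_sub_jump_le {f : ℝ → ℝ} (hf : BoundedVariationOn f (Icc (0 : ℝ) 1))
    {x δ t : ℝ} (hx : x ∈ Ioo (0 : ℝ) 1) (hδ : 0 < δ) (ht : t ∈ Icc (0 : ℝ) 1) (htx : t ≠ x) :
    |f t - ((1 / 2 : ℝ) * (Function.rightLim f x + Function.leftLim f x)
      + (1 / 2 : ℝ) * (Function.rightLim f x - Function.leftLim f x) * Real.sign (t - x))|
      ≤ quasiModulus f x δ + 2 * supNorm01 f / δ ^ 2 * (t - x) ^ 2 := by
  have hM := supNorm01_nonneg f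
  have hΩ := quasiModulus_nonneg f x δ
  have hft := abs_le_supNorm01 hf ht
  have hq : 0 ≤ 2 * supNorm01 f / δ ^ 2 * (t - x) ^ 2 := by positivity
  rcases htx.lt_or_gt with h | h
  · rw [Real.sign_of_neg (sub_neg.2 h), show ∀ u v w : ℝ, u - (1 / 2 * (v + w)
      + 1 / 2 * (v - w) * (-1)) = -(w - u) by intros; ring, abs_neg]
    rcases le_or_gt (x - δ) t with hd | hd
    · linarith [abs_leftLim_sub_le_quasiModulus hf ⟨hd, h⟩ ht]
    · have := two_mul_le_mul_sq_div hM hδ (y := t - x)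
        (by rw [abs_of_neg (sub_neg.2 h)]; linarith)
      linarith [abs_sub (Function.leftLim f x) (f t), abs_leftLim_le_supNorm01 hf hx]
  · rw [Real.sign_of_pos (sub_pos.2 h), show ∀ u v w : ℝ, u - (1 / 2 * (v + w)
      + 1 / 2 * (v - w) * 1) = -(v - u) by intros; ring, abs_neg]
    rcases le_or_gt t (x + δ) with hd | hd
    · linarith [abs_rightLim_sub_le_quasiModulus hf ⟨h, hd⟩ ht]
    · have := two_mul_le_mul_sq_div hM hδ (y := t - x)
        (by rw [abs_of_pos (sub_pos.2 h)]; linarith)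
      linarith [abs_sub (Function.rightLim f x) (f t), abs_rightLim_le_supNorm01 hf hx]

theorem kantorovich_const_add_mul_sq (n : ℕ) (x a b : ℝ) :
    kantorovich n (fun t => a + b * (t - x) ^ 2) x
      = a + b * kantorovich n (fun t => (t - x) ^ 2) x := by
  have ha : a = ∑ k ∈ Finset.range (n + 1), a * binomialWeight n x k := by
    rw [← Finset.mul_sum, sum_binomialWeight, mul_one]
  simp_rw [kantorovich_eq_sum_cellMean]
  conv_rhs => rw [ha, Finset.mul_sum, ← Finset.sum_add_distrib]
  refine Finset.sum_congr rfl fun k _ => ?_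
  rw [← mul_assoc, ← add_mul]
  congr 1
  have hc : a = cellMean n (fun _ => a) k := (cellMean_const n k a).symm
  simp only [cellMean] at hc ⊢
  rw [intervalIntegral.integral_add intervalIntegrable_const
      ((by fun_prop : Continuous fun t : ℝ => b * (t - x) ^ 2).intervalIntegrable _ _),
    intervalIntegral.integral_const_mul]
  linear_combination -hc

/-- The quantitative pointwise estimate for functions of bounded variation. -/
theorem abs_kantorovich_sub_half_le {f : ℝ → ℝ} (hf : BoundedVariationOn f (Icc (0 : ℝ) 1))
    {x δ : ℝ} (hx : x ∈ Ioo (0 : ℝ) 1) (hδ : 0 < δ) {n : ℕ} (hn : 1 ≤ n) :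
    |kantorovich n f x - (1 / 2 : ℝ) * (Function.rightLim f x + Function.leftLim f x)|
      ≤ 2 * quasiModulus f x δ + supNorm01 f *
          (1 / ((n : ℝ) * δ ^ 2) + 12 / Real.sqrt ((n : ℝ) * x * (1 - x))) := by
  have hn0 : (0 : ℝ) < n := by exact_mod_cast hn
  have hM := supNorm01_nonneg f
  have hΩ := quasiModulus_nonneg f x δ
  have h1 := abs_kantorovich_sub_le (n := n) hx (intervalIntegrable_of_bv hf)
    (by fun_prop) (fun t ht htx => abs_sub_jump_le hf hx hδ ht htx)
  rw [kantorovich_const_add_mul_sq] at h1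
  have h2 : 2 * supNorm01 f / δ ^ 2 * kantorovich n (fun t => (t - x) ^ 2) x
      ≤ supNorm01 f * (1 / ((n : ℝ) * δ ^ 2)) := by
    refine (mul_le_mul_of_nonneg_left (kantorovich_sub_sq_le hn hx) (by positivity)).trans_eq ?_
    field_simp
  have h3 : |(1 / 2 : ℝ) * (Function.rightLim f x - Function.leftLim f x)
      * kantorovich n (fun t => Real.sign (t - x)) x|
      ≤ supNorm01 f * (12 / Real.sqrt ((n : ℝ) * x * (1 - x))) := by
    rw [abs_mul]
    refine mul_le_mul ?_ (abs_kantorovich_sign_le hn hx) (abs_nonneg _) hM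
    rw [abs_mul, abs_of_pos (by norm_num : (0 : ℝ) < 1 / 2)]
    linarith [abs_sub (Function.rightLim f x) (Function.leftLim f x),
      abs_rightLim_le_supNorm01 hf hx, abs_leftLim_le_supNorm01 hf hx]
  rw [mul_add]
  rw [abs_le] at h1 h3 ⊢
  -- The argument gives `Ω` with coefficient `1`; `hΩ` weakens it to `2`.
  constructor <;> linarith

/-! ### Pointwise convergence -/

theorem exists_quasiModulus_le {f : ℝ → ℝ} (hf : BoundedVariationOn f (Icc (0 : ℝ) 1))
    {x ε : ℝ} (hx : x ∈ Ioo (0 : ℝ) 1) (hε : 0 < ε) : ∃ δ > 0, quasiModulus f x δ ≤ ε := by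
  have hl := (tendsto_leftLim_of_bv hf hx).eventually (Metric.ball_mem_nhds _ hε)
  have hr := (tendsto_rightLim_of_bv hf hx).eventually (Metric.ball_mem_nhds _ hε)
  obtain ⟨l, hlx, hl⟩ := (mem_nhdsLT_iff_exists_Ioo_subset).1 hl
  obtain ⟨r, hrx, hr⟩ := (mem_nhdsGT_iff_exists_Ioo_subset).1 hr
  have hlx : l < x := hlx
  have hrx : x < r := hrx
  have hδ : 0 < min (x - l) (r - x) := lt_min (sub_pos.2 hlx) (sub_pos.2 hrx)
  have hδl := min_le_left (x - l) (r - x)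
  have hδr := min_le_right (x - l) (r - x)
  -- Halving fits the closed ends `x ± δ` into the open intervals.
  refine ⟨min (x - l) (r - x) / 2, half_pos hδ, max_le ?_ ?_⟩
  · refine Real.sSup_le ?_ hε.le
    rintro _ ⟨t, ⟨ht, -⟩, rfl⟩
    have h := hl (show t ∈ Ioo l x from ⟨by linarith [ht.1], ht.2⟩)
    rw [mem_ofPred_eq, dist_comm, Real.dist_eq] at h
    exact h.le
  · refine Real.sSup_le ?_ hε.le
    rintro _ ⟨t, ⟨ht, -⟩, rfl⟩
    have h := hr (show t ∈ Ioo x r from ⟨ht.1, by linarith [ht.2]⟩)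
    rw [mem_ofPred_eq, dist_comm, Real.dist_eq] at h
    exact h.le

theorem tendsto_kantorovich_error_bound (M : ℝ) {x δ : ℝ} (hx : x ∈ Ioo (0 : ℝ) 1) (hδ : 0 < δ) :
    Tendsto (fun n : ℕ => M * (1 / ((n : ℝ) * δ ^ 2) + 12 / Real.sqrt ((n : ℝ) * x * (1 - x))))
      atTop (𝓝 0) := by
  have hn : Tendsto (fun n : ℕ => (n : ℝ)) atTop atTop := tendsto_natCast_atTop_atTop
  have h1 : Tendsto (fun n : ℕ => 1 / ((n : ℝ) * δ ^ 2)) atTop (𝓝 0) :=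
    (hn.atTop_mul_const (by positivity)).const_div_atTop 1
  have h2 : Tendsto (fun n : ℕ => 12 / Real.sqrt ((n : ℝ) * x * (1 - x))) atTop (𝓝 0) :=
    (Real.tendsto_sqrt_atTop.comp
      ((hn.atTop_mul_const hx.1).atTop_mul_const (sub_pos.2 hx.2))).const_div_atTop 12
  simpa using (h1.add h2).const_mul M

theorem tendsto_abs_kantorovich_sub_half {f : ℝ → ℝ}
    (hf : BoundedVariationOn f (Icc (0 : ℝ) 1)) {x : ℝ} (hx : x ∈ Ioo (0 : ℝ) 1) :
    Tendsto (fun n : ℕ =>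
        |kantorovich n f x - (1 / 2 : ℝ) * (Function.rightLim f x + Function.leftLim f x)|)
      atTop (𝓝 0) := by
  refine tendsto_order.2 ⟨fun a ha => Eventually.of_forall fun n => ha.trans_le (abs_nonneg _),
    fun ε hε => ?_⟩
  -- Fix `δ` before `n`: `2Ω` uses `ε/2`, and the rest of the bound tends to `0`.
  obtain ⟨δ, hδ, hΩ⟩ := exists_quasiModulus_le hf hx (by positivity : 0 < ε / 4)
  filter_upwards [(tendsto_kantorovich_error_bound (supNorm01 f) hx hδ).eventually_lt_const
    (half_pos hε), eventually_ge_atTop 1] with n h1 h2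
  linarith [abs_kantorovich_sub_half_le hf hx hδ h2]

end

theorem mainTheorem8 :
    (∀ x ∈ Ioo (0 : ℝ) 1, ∀ n : ℕ, 1 ≤ n →
      |kantorovich n (fun t => Real.sign (t - x)) x|
        ≤ 12 / Real.sqrt ((n : ℝ) * x * (1 - x))) ∧
    (∀ f : ℝ → ℝ, BoundedVariationOn f (Icc (0 : ℝ) 1) → ∀ x ∈ Ioo (0 : ℝ) 1,
      (∀ δ : ℝ, 0 < δ → ∀ n : ℕ, 1 ≤ n →
        |kantorovich n f x - (1 / 2 : ℝ) * (Function.rightLim f x + Function.leftLim f x)|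
          ≤ 2 * quasiModulus f x δ
            + supNorm01 f *
              (1 / ((n : ℝ) * δ ^ 2) + 12 / Real.sqrt ((n : ℝ) * x * (1 - x)))) ∧
      Tendsto
        (fun n : ℕ =>
          |kantorovich n f x - (1 / 2 : ℝ) * (Function.rightLim f x + Function.leftLim f x)|)
        atTop (𝓝 0)) := by
  exact ⟨fun x hx n hn => abs_kantorovich_sign_le hn hx, fun f hf x hx =>
    ⟨fun δ hδ n hn => abs_kantorovich_sub_half_le hf hx hδ hn,
      tendsto_abs_kantorovich_sub_half hf hx⟩⟩
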